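/- Let $r\ge 1$ and let $A,R,S$ be real $r\times r$ matrices with $R,S$ symmetric positive semi-definite, and let $R^{1/2},S^{1/2}$ be symmetric square roots of $R,S$. Suppose that $(A,R^{1/2})$ is controllable and $(A,S^{1/2})$ is observable. Write $M'$ for the transpose of $M$ and $\Lambda(P):=AP+PA'+R-PSP$. Then there is exactly one positive definite matrix $P_\infty$ such that $\Lambda(P_\infty)=0$ and $B:=A-P_\infty S$ is Hurwitz (all its eigenvalues have negative real part), and for each positive semi-definite $Q$ the Riccati equation $\partial_tP_t=\Lambda(P_t)$, $P_0=Q$, has exactly one solution on $[0,\infty)$; denote it by $P_t=\phi_t(Q)$. Let $E_t(Q)$ be the solution of $\partial_tE_t(Q)=(A-\phi_t(Q)S)E_t(Q)$, $E_0(Q)=I$. Then $E_t(P_\infty)=e^{tB}$ for all $t\ge 0$. For $t>0$ put $$\mathbb S_t:=\int_0^t e^{sB'}S\,e^{sB}\,ds,\qquad \mathbb S_\infty:=\int_0^\infty e^{sB'}S\,e^{sB}\,ds=\lim_{t\to\infty}\mathbb S_t,\qquad P_\infty^-:=P_\infty-\mathbb S_\infty^{-1},$$ $$\mathbb C_t(Q):=\left[(\mathbb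 S_t^{-1}-\mathbb S_\infty^{-1})+(Q-P_\infty^-)\right]\mathbb S_t .$$ The integral over $[0,\infty)$ converges, $\mathbb S_t$ and $\mathbb S_\infty$ are positive definite, and for each $t>0$ and each positive semi-definite $Q$ the matrix $\mathbb C_t(Q)=I+(Q-P_\infty)\mathbb S_t$ is invertible. For all $t>0$ and all positive semi-definite $Q_1,Q_2$, $$\phi_t(Q_1)-\phi_t(Q_2)=E_t(P_\infty)\,\mathbb C_t(Q_1)^{-1}(Q_1-Q_2)\left(E_t(P_\infty)\,\mathbb C_t(Q_2)^{-1}\right)',\qquad E_t(P_\infty)=e^{tB}.$$ In particular, for all $t>0$ and all positive semi-definite $Q$, $$\phi_t(Q)=P_\infty+e^{tB}\left[I+(Q-P_\infty)\,\mathbb S_t\right]^{-1}(Q-P_\infty)\,e^{tB'}.$$ -/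

import Mathlib

open Filter Topology MeasureTheory
open scoped Matrix Matrix.Norms.L2Operator

noncomputable section

namespace Riccati

variable {r : ℕ}

/-- The pair `(A, G)` is controllable: the Kalman matrix `[G, AG, …, A^(r-1) G]` has rank `r`. -/
def IsControllable (A G : Matrix (Fin r) (Fin r) ℝ) : Prop :=
  (Matrix.of fun (i : Fin r) (p : Fin r × Fin r) => (A ^ (p.1 : ℕ) * G) i p.2).rank = r

/-- The pair `(A, H)` is observable: the matrix obtained by stacking `H, HA, …, H A^(r-1)`
has rank `r`. -/
def IsObservable (A H : Matrix (Fin r) (Fin r) ℝ) : Prop :=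
  (Matrix.of fun (p : Fin r × Fin r) (j : Fin r) => (H * A ^ (p.1 : ℕ)) p.2 j).rank = r

/-- All complex eigenvalues of the real matrix `B` have negative real part. -/
def IsHurwitz (B : Matrix (Fin r) (Fin r) ℝ) : Prop :=
  ∀ z ∈ spectrum ℂ (B.map (algebraMap ℝ ℂ)), z.re < 0

/-- The Riccati drift `Λ(P) = A P + P A' + R - P S P`. -/
def drift (A R S P : Matrix (Fin r) (Fin r) ℝ) : Matrix (Fin r) (Fin r) ℝ :=
  A * P + P * Aᵀ + R - P * S * P

/-- `P` solves `∂ₜ P = Λ(P)` on `[0, ∞)` with `P 0 = Q`. -/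
def IsSolution (A R S Q : Matrix (Fin r) (Fin r) ℝ) (P : ℝ → Matrix (Fin r) (Fin r) ℝ) : Prop :=
  P 0 = Q ∧ ∀ t : ℝ, 0 ≤ t → HasDerivWithinAt P (drift A R S (P t)) (Set.Ici 0) t

/-- The Riccati flow `φ_t(Q)`: the value at time `t ≥ 0` of the solution started at `Q`. -/
def flow (A R S : Matrix (Fin r) (Fin r) ℝ) (t : ℝ) (Q : Matrix (Fin r) (Fin r) ℝ) :
    Matrix (Fin r) (Fin r) ℝ :=
  Classical.epsilon (IsSolution A R S Q) t

/-- `E` solves `∂ₜ E = (A - φ_t(Q) S) E` on `[0, ∞)` with `E 0 = I`. -/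
def IsTransition (A R S Q : Matrix (Fin r) (Fin r) ℝ)
    (E : ℝ → Matrix (Fin r) (Fin r) ℝ) : Prop :=
  E 0 = 1 ∧ ∀ t : ℝ, 0 ≤ t →
    HasDerivWithinAt E ((A - flow A R S t Q * S) * E t) (Set.Ici 0) t

/-- The exponential semigroup (state transition matrix) `E_t(Q) = E_{0,t}(Q)`. -/
def transition (A R S : Matrix (Fin r) (Fin r) ℝ) (t : ℝ) (Q : Matrix (Fin r) (Fin r) ℝ) :
    Matrix (Fin r) (Fin r) ℝ :=
  Classical.epsilon (IsTransition A R S Q) t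

/-- `P` is a positive definite solution of the algebraic Riccati equation `Λ(P) = 0` for which
`A - P S` is Hurwitz. -/
def IsStabilizing (A R S P : Matrix (Fin r) (Fin r) ℝ) : Prop :=
  P.PosDef ∧ drift A R S P = 0 ∧ IsHurwitz (A - P * S)

/-- The stabilizing steady state `P_∞`. -/
def steady (A R S : Matrix (Fin r) (Fin r) ℝ) : Matrix (Fin r) (Fin r) ℝ :=
  Classical.epsilon (IsStabilizing A R S)

/-- `B = A - P_∞ S`. -/
def closedLoop (A R S : Matrix (Fin r) (Fin r) ℝ) : Matrix (Fin r) (Fin r) ℝ :=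
  A - steady A R S * S

/-- The integrand `e^{sB'} S e^{sB}` of the Gramian. -/
def gramIntegrand (A R S : Matrix (Fin r) (Fin r) ℝ) (s : ℝ) : Matrix (Fin r) (Fin r) ℝ :=
  NormedSpace.exp (s • (closedLoop A R S)ᵀ) * S * NormedSpace.exp (s • closedLoop A R S)

/-- The Gramian `𝕊_t = ∫_0^t e^{sB'} S e^{sB} ds`. -/
def gram (A R S : Matrix (Fin r) (Fin r) ℝ) (t : ℝ) : Matrix (Fin r) (Fin r) ℝ :=
  ∫ s in (0 : ℝ)..t, gramIntegrand A R S s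

/-- The steady state Gramian `𝕊_∞ = ∫_0^∞ e^{sB'} S e^{sB} ds`. -/
def gramInf (A R S : Matrix (Fin r) (Fin r) ℝ) : Matrix (Fin r) (Fin r) ℝ :=
  ∫ s in Set.Ioi (0 : ℝ), gramIntegrand A R S s

/-- `P_∞⁻ = P_∞ - 𝕊_∞⁻¹`. -/
def steadyNeg (A R S : Matrix (Fin r) (Fin r) ℝ) : Matrix (Fin r) (Fin r) ℝ :=
  steady A R S - (gramInf A R S)⁻¹

/-- `ℂ_t(Q) = [(𝕊_t⁻¹ - 𝕊_∞⁻¹) + (Q - P_∞⁻)] 𝕊_t`. -/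
def floquetC (A R S : Matrix (Fin r) (Fin r) ℝ) (t : ℝ) (Q : Matrix (Fin r) (Fin r) ℝ) :
    Matrix (Fin r) (Fin r) ℝ :=
  (((gram A R S t)⁻¹ - (gramInf A R S)⁻¹) + (Q - steadyNeg A R S)) * gram A R S t

end Riccati

end

/-!
The matrix `P_∞` comes from the Newton (Kleinman) iteration for the algebraic Riccati equation, and
everything about the flow comes from an explicit formula for the solutions.

*Steady state.* Controllability and observability are used in Hautus' form `NoInvariantKer`: no
nonzero `A`-invariant subspace lies in the kernel of `S` (respectively, with `Aᵀ` and `R`). If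
`MᵀW + WM = -Q` with `W`, `Q` positive semidefinite and no nonzero `M`-invariant subspace in `ker Q`,
then `W` is positive definite and `M` is Hurwitz (`posDef_and_isHurwitz_of_lyapunov`). Conversely, for
Hurwitz `M` the powers of `e^M` tend to zero, by Gelfand's formula and spectral mapping for the
exponential, so the Lyapunov equation is uniquely solvable and its solution is positive semidefinite
(`exists_lyapunov`, `posSemidef_of_lyapunov`). Bass' construction supplies a symmetric `P₀` with
`A - P₀S` Hurwitz (`exists_isHurwitz_sub_mul`). From there the iteration
`(A - PₖS)Pₖ₊₁ + Pₖ₊₁(A - PₖS)ᵀ = -(R + PₖSPₖ)` stays stabilizing and is decreasing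
(`newton_step`, `newton_antitone`), and its limit is `P_∞`. Two stabilizing solutions agree because
their difference solves a homogeneous Sylvester equation with Hurwitz coefficients.

*Gramian.* With `N = P_∞⁻¹` the Riccati equation reads `BᵀN + NB = -(S + NRN)`, so that
`e^{tBᵀ} N e^{tB} + 𝕊_t` decreases from `N` and `𝕊_t < N` (`dotProduct_gram_lt`). This bounds the
integral over `[0, ∞)`, and it makes `I + (Q - P_∞)𝕊_t` invertible for `Q ≥ 0`
(`isUnit_one_add_mul_gram`).

*Flow.* Hence `P_∞ + e^{tB} (I + (Q - P_∞)𝕊_t)⁻¹ (Q - P_∞) e^{tBᵀ}` is defined for all `t ≥ 0`, and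
differentiation shows that it solves the Riccati equation (`isSolution_explicit`). The vector field is
polynomial, so solutions are unique, and the formula for the difference of two flows is the algebraic
identity `inv_mul_sub_inv_mul`.
-/

namespace Riccati

variable {r : ℕ}

/-! ### Invariant subspaces in kernels -/

/-- No nonzero `A`-invariant subspace is contained in the kernel of `S`. This is Hautus' form of the
observability of `(A, S)`, and of the controllability of `(Aᵀ, Sᵀ)`. -/
def NoInvariantKer (A S : Matrix (Fin r) (Fin r) ℝ) : Prop :=
  ∀ U : Submodule ℝ (Fin r → ℝ), (∀ x ∈ U, A *ᵥ x ∈ U) → (∀ x ∈ U, S *ᵥ x = 0) → U = ⊥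

/-- The property only depends on `ker S` and on the restriction of `A` to it; in particular it is
insensitive to output feedback. -/
theorem NoInvariantKer.of_ker {A S L Q : Matrix (Fin r) (Fin r) ℝ} (h : NoInvariantKer A S)
    (hker : ∀ x, Q *ᵥ x = 0 → S *ᵥ x = 0 ∧ L *ᵥ x = A *ᵥ x) : NoInvariantKer L Q := by
  intro U hU hQ
  refine h U (fun x hx => ?_) fun x hx => (hker x (hQ x hx)).1
  rw [← (hker x (hQ x hx)).2]
  exact hU x hx

theorem IsObservable.noInvariantKer {A H : Matrix (Fin r) (Fin r) ℝ} (h : IsObservable A H) :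
    NoInvariantKer A (Hᵀ * H) := by
  intro U hU hH
  rw [Submodule.eq_bot_iff]
  intro x hx
  have hpow : ∀ k : ℕ, A ^ k *ᵥ x ∈ U := by
    intro k
    induction k with
    | zero => simpa using hx
    | succ k ih => rw [pow_succ', ← Matrix.mulVec_mulVec]; exact hU _ ih
  have hHz : ∀ y ∈ U, H *ᵥ y = 0 := fun y hy =>
    (Matrix.conjTranspose_mul_self_mulVec_eq_zero H y).1
      (by rw [Matrix.conjTranspose_eq_transpose_of_trivial]; exact hH y hy)
  unfold IsObservable at h
  set M : Matrix (Fin r × Fin r) (Fin r) ℝ :=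
    Matrix.of fun (p : Fin r × Fin r) (j : Fin r) => (H * A ^ (p.1 : ℕ)) p.2 j with hM
  have hker : LinearMap.ker M.mulVecLin = ⊥ := by
    have h1 := LinearMap.finrank_range_add_finrank_ker M.mulVecLin
    rw [Module.finrank_fin_fun] at h1
    have h2 : Module.finrank ℝ (LinearMap.range M.mulVecLin) = r := h
    exact Submodule.finrank_eq_zero.1 (by omega)
  have hx0 : x ∈ LinearMap.ker M.mulVecLin := by
    rw [LinearMap.mem_ker, Matrix.mulVecLin_apply]
    funext p
    have h3 := congrFun (hHz _ (hpow p.1)) p.2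
    rw [Matrix.mulVec_mulVec] at h3
    exact h3
  rw [hker] at hx0
  simpa using hx0

theorem IsControllable.isObservable_transpose {A G : Matrix (Fin r) (Fin r) ℝ}
    (h : IsControllable A G) : IsObservable Aᵀ Gᵀ := by
  unfold IsControllable at h
  unfold IsObservable
  rw [← Matrix.rank_transpose] at h
  refine Eq.trans (congrArg Matrix.rank ?_) h
  ext p j
  simp [← Matrix.transpose_pow, ← Matrix.transpose_mul]

/-! ### Eigenvectors and Lyapunov's stability criterion -/

theorem exists_mulVec_eq_smul_of_mem_spectrum {C : Matrix (Fin r) (Fin r) ℂ} {z : ℂ}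
    (hz : z ∈ spectrum ℂ C) : ∃ v : Fin r → ℂ, v ≠ 0 ∧ C *ᵥ v = z • v := by
  rw [← Matrix.spectrum_toLin', ← Module.End.hasEigenvalue_iff_mem_spectrum] at hz
  obtain ⟨v, hv⟩ := hz.exists_hasEigenvector
  exact ⟨v, hv.2, by simpa using hv.apply_eq_smul⟩

theorem mem_spectrum_of_mulVec_eq_smul {C : Matrix (Fin r) (Fin r) ℂ} {z : ℂ}
    {v : Fin r → ℂ} (hv : v ≠ 0) (h : C *ᵥ v = z • v) : z ∈ spectrum ℂ C := by
  rw [← Matrix.spectrum_toLin', ← Module.End.hasEigenvalue_iff_mem_spectrum]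
  exact Module.End.hasEigenvalue_of_hasEigenvector (x := v)
    ⟨Module.End.mem_eigenspace_iff.2 (by simpa using h), hv⟩

theorem IsHurwitz.transpose {L : Matrix (Fin r) (Fin r) ℝ} (h : IsHurwitz L) :
    IsHurwitz Lᵀ := by
  intro z hz
  apply h z
  rw [Matrix.mem_spectrum_iff_isRoot_charpoly] at hz ⊢
  rwa [Matrix.transpose_map, Matrix.charpoly_transpose] at hz

/-- The real and imaginary parts of a complex eigenvector of a real matrix span a real invariant
subspace. -/
theorem exists_re_im_of_mem_spectrum {L : Matrix (Fin r) (Fin r) ℝ} {z : ℂ}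
    (hz : z ∈ spectrum ℂ (L.map (algebraMap ℝ ℂ))) : ∃ x y : Fin r → ℝ, (x ≠ 0 ∨ y ≠ 0) ∧
      L *ᵥ x = z.re • x - z.im • y ∧ L *ᵥ y = z.re • y + z.im • x := by
  obtain ⟨v, hv, h⟩ := exists_mulVec_eq_smul_of_mem_spectrum hz
  refine ⟨fun i => (v i).re, fun i => (v i).im, ?_, ?_, ?_⟩
  · by_contra! hc
    exact hv (funext fun i => Complex.ext (congrFun hc.1 i) (congrFun hc.2 i))
  · funext i
    have := congrArg Complex.re (congrFun h i)
    simpa [Matrix.mulVec, dotProduct] using this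
  · funext i
    have := congrArg Complex.im (congrFun h i)
    simpa [Matrix.mulVec, dotProduct] using this

theorem lyapunov_quadratic {M W Q : Matrix (Fin r) (Fin r) ℝ} (hW : Wᵀ = W)
    (hly : Mᵀ * W + W * M = -Q) (x : Fin r → ℝ) :
    x ⬝ᵥ (Q *ᵥ x) = -2 * ((W *ᵥ x) ⬝ᵥ (M *ᵥ x)) := by
  have h1 : Q = -(Mᵀ * W + W * M) := by rw [hly, neg_neg]
  rw [h1, Matrix.neg_mulVec, Matrix.add_mulVec, ← Matrix.mulVec_mulVec, ← Matrix.mulVec_mulVec,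
    dotProduct_neg, dotProduct_add, Matrix.dotProduct_mulVec x Mᵀ, Matrix.vecMul_transpose,
    Matrix.dotProduct_mulVec x W, ← Matrix.mulVec_transpose, hW, dotProduct_comm (M *ᵥ x)]
  ring

theorem dotProduct_mulVec_symm {W : Matrix (Fin r) (Fin r) ℝ} (hW : Wᵀ = W) (x y : Fin r → ℝ) :
    (W *ᵥ x) ⬝ᵥ y = (W *ᵥ y) ⬝ᵥ x := by
  rw [dotProduct_comm, Matrix.dotProduct_mulVec, ← Matrix.mulVec_transpose, hW]

theorem posDef_of_ker {W : Matrix (Fin r) (Fin r) ℝ} (hW : W.PosSemidef)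
    (h : ∀ x, W *ᵥ x = 0 → x = 0) : W.PosDef := by
  refine Matrix.PosDef.of_dotProduct_mulVec_pos hW.isHermitian fun x hx => ?_
  refine lt_of_le_of_ne (hW.dotProduct_mulVec_nonneg x) fun h0 => hx (h x ?_)
  exact (hW.dotProduct_mulVec_zero_iff x).1 h0.symm

/-- Lyapunov's stability criterion with a semidefinite right-hand side: the kernel of `W` is an
`M`-invariant subspace of `ker Q`, and so is the span of the real and imaginary parts of an eigenvector
whose eigenvalue has nonnegative real part. -/
theorem posDef_and_isHurwitz_of_lyapunov {M W Q : Matrix (Fin r) (Fin r) ℝ} (hW : W.PosSemidef)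
    (hQ : Q.PosSemidef) (hly : Mᵀ * W + W * M = -Q) (hMQ : NoInvariantKer M Q) :
    W.PosDef ∧ IsHurwitz M := by
  have hWs : Wᵀ = W := by
    rw [← Matrix.conjTranspose_eq_transpose_of_trivial]; exact hW.isHermitian
  have hQn : ∀ x : Fin r → ℝ, 0 ≤ x ⬝ᵥ (Q *ᵥ x) := fun x => by
    simpa using hQ.dotProduct_mulVec_nonneg x
  have hQz : ∀ x : Fin r → ℝ, x ⬝ᵥ (Q *ᵥ x) = 0 → Q *ᵥ x = 0 := fun x hx =>
    (hQ.dotProduct_mulVec_zero_iff x).1 (by simpa using hx)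
  have hWd : W.PosDef := by
    refine posDef_of_ker hW fun x hx => ?_
    have hker : ∀ y, W *ᵥ y = 0 → Q *ᵥ y = 0 := fun y hy =>
      hQz y (by rw [lyapunov_quadratic hWs hly, hy]; simp)
    have hbot := hMQ (LinearMap.ker W.mulVecLin) (fun y hy => ?_) fun y hy =>
      hker y (by simpa using hy)
    · have : x ∈ LinearMap.ker W.mulVecLin := by simpa using hx
      rw [hbot] at this
      simpa using this
    · have hy' : W *ᵥ y = 0 := by simpa using hy
      have h2 := congrArg (· *ᵥ y) hly
      simp only [Matrix.add_mulVec, Matrix.neg_mulVec, ← Matrix.mulVec_mulVec, hy', hker y hy',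
        Matrix.mulVec_zero, zero_add, neg_zero] at h2
      simpa using h2
  refine ⟨hWd, fun z hz => ?_⟩
  obtain ⟨x, y, hxy, hx, hy⟩ := exists_re_im_of_mem_spectrum hz
  by_contra! hre
  have hWn : ∀ x : Fin r → ℝ, 0 ≤ (W *ᵥ x) ⬝ᵥ x := fun x => by
    rw [dotProduct_comm]; simpa using hW.dotProduct_mulVec_nonneg x
  have hsum : x ⬝ᵥ (Q *ᵥ x) + y ⬝ᵥ (Q *ᵥ y)
      = -2 * z.re * ((W *ᵥ x) ⬝ᵥ x + (W *ᵥ y) ⬝ᵥ y) := by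
    rw [lyapunov_quadratic hWs hly, lyapunov_quadratic hWs hly, hx, hy]
    simp only [dotProduct_sub, dotProduct_add, dotProduct_smul, smul_eq_mul]
    rw [dotProduct_mulVec_symm hWs y x]
    ring
  have hle : x ⬝ᵥ (Q *ᵥ x) + y ⬝ᵥ (Q *ᵥ y) ≤ 0 := by
    rw [hsum]
    nlinarith [mul_nonneg hre (add_nonneg (hWn x) (hWn y))]
  have hQx := hQz x (by linarith [hQn x, hQn y])
  have hQy := hQz y (by linarith [hQn x, hQn y])
  have hxs : x ∈ Submodule.span ℝ {x, y} := Submodule.subset_span (by simp)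
  have hys : y ∈ Submodule.span ℝ {x, y} := Submodule.subset_span (by simp)
  have hbot := hMQ (Submodule.span ℝ {x, y}) (fun w hw => ?_) fun w hw => ?_
  · rw [hbot, Submodule.mem_bot] at hxs hys
    exact hxy.elim (fun h => h hxs) fun h => h hys
  · obtain ⟨a, b, rfl⟩ := Submodule.mem_span_pair.1 hw
    rw [Matrix.mulVec_add, Matrix.mulVec_smul, Matrix.mulVec_smul, hx, hy]
    exact add_mem (Submodule.smul_mem _ _ (sub_mem (Submodule.smul_mem _ _ hxs)
      (Submodule.smul_mem _ _ hys))) (Submodule.smul_mem _ _ (add_mem (Submodule.smul_mem _ _ hys)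
      (Submodule.smul_mem _ _ hxs)))
  · obtain ⟨a, b, rfl⟩ := Submodule.mem_span_pair.1 hw
    rw [Matrix.mulVec_add, Matrix.mulVec_smul, Matrix.mulVec_smul, hQx, hQy]
    simp

/-! ### Decay of the exponential of a Hurwitz matrix -/

theorem exp_mulVec_eq_smul {C : Matrix (Fin r) (Fin r) ℂ} {z : ℂ} {v : Fin r → ℂ}
    (h : C *ᵥ v = z • v) : NormedSpace.exp C *ᵥ v = Complex.exp z • v := by
  let _ : NormedAlgebra ℚ (Matrix (Fin r) (Fin r) ℂ) := NormedAlgebra.restrictScalars ℚ ℂ _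
  -- the matrix all of whose columns are `v` intertwines `z • 1` and `C`
  have hsemi : SemiconjBy (Matrix.vecMulVec v 1) (algebraMap ℂ (Matrix (Fin r) (Fin r) ℂ) z) C := by
    rw [SemiconjBy, Matrix.mul_vecMulVec, h, Algebra.algebraMap_eq_smul_one, Matrix.mul_smul,
      Matrix.mul_one, Matrix.smul_vecMulVec]
  have hexp := hsemi.exp_right
  rw [SemiconjBy, ← NormedSpace.algebraMap_exp_comm, Matrix.mul_vecMulVec,
    Algebra.algebraMap_eq_smul_one, Matrix.mul_smul, Matrix.mul_one, ← Matrix.smul_vecMulVec,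
    ← Complex.exp_eq_exp_ℂ] at hexp
  funext i
  have := congrFun (congrFun hexp i) i
  simpa [Matrix.vecMulVec_apply] using this.symm

/-- The nontrivial inclusion of the spectral mapping theorem for the exponential: an eigenspace of
`exp C` is invariant under `C`, hence contains an eigenvector of `C`. -/
theorem exists_exp_eq_of_mem_spectrum_exp {C : Matrix (Fin r) (Fin r) ℂ} {μ : ℂ}
    (hμ : μ ∈ spectrum ℂ (NormedSpace.exp C)) : ∃ z ∈ spectrum ℂ C, Complex.exp z = μ := by
  let _ : NormedAlgebra ℚ (Matrix (Fin r) (Fin r) ℂ) := NormedAlgebra.restrictScalars ℚ ℂ _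
  obtain ⟨w, hw, hwμ⟩ := exists_mulVec_eq_smul_of_mem_spectrum hμ
  set E := Module.End.eigenspace (Matrix.toLin' (NormedSpace.exp C)) μ with hE
  have hmem : ∀ v, v ∈ E ↔ NormedSpace.exp C *ᵥ v = μ • v := fun v => by
    rw [hE, Module.End.mem_eigenspace_iff, Matrix.toLin'_apply]
  have hcomm : C * NormedSpace.exp C = NormedSpace.exp C * C := (Commute.refl C).exp_right
  have hmaps : ∀ v ∈ E, Matrix.toLin' C v ∈ E := fun v hv => by
    rw [hmem] at hv ⊢
    rw [Matrix.toLin'_apply, Matrix.mulVec_mulVec, ← hcomm, ← Matrix.mulVec_mulVec, hv,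
      Matrix.mulVec_smul]
  have : Nontrivial E :=
    ⟨⟨⟨w, (hmem w).2 hwμ⟩, 0, fun h => hw (congrArg Subtype.val h)⟩⟩
  obtain ⟨z, hz⟩ := Module.End.exists_eigenvalue ((Matrix.toLin' C).restrict hmaps)
  obtain ⟨⟨v, hvE⟩, hv⟩ := hz.exists_hasEigenvector
  have hv0 : v ≠ 0 := fun h => hv.2 (Subtype.ext h)
  have hCv : C *ᵥ v = z • v := by
    have := congrArg Subtype.val hv.apply_eq_smul
    simpa using this
  refine ⟨z, mem_spectrum_of_mulVec_eq_smul hv0 hCv, ?_⟩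
  have h1 := exp_mulVec_eq_smul hCv
  rw [(hmem v).1 hvE] at h1
  exact (smul_left_injective ℂ hv0 h1).symm

theorem tendsto_pow_of_spectralRadius_lt_one {A : Type*} [NormedRing A] [NormedAlgebra ℂ A]
    [CompleteSpace A] {a : A} (ha : spectralRadius ℂ a < 1) :
    Tendsto (fun n : ℕ => a ^ n) atTop (𝓝 0) := by
  obtain ⟨c, hc, hc1⟩ := ENNReal.lt_iff_exists_nnreal_btwn.1 ha
  have hev := (spectrum.pow_nnnorm_pow_one_div_tendsto_nhds_spectralRadius a).eventually_lt_const hc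
  have hc1' : (c : ℝ) < 1 := by exact_mod_cast hc1
  refine squeeze_zero_norm' ?_ (tendsto_pow_atTop_nhds_zero_of_lt_one c.2 hc1')
  filter_upwards [hev, eventually_gt_atTop 0] with n hn hn0
  have hn0' : (0 : ℝ) < n := by exact_mod_cast hn0
  have h2 : (‖a ^ n‖₊ : ENNReal) ≤ (c : ENNReal) ^ n := by
    have h3 := ENNReal.rpow_le_rpow hn.le hn0'.le
    rwa [← ENNReal.rpow_mul, one_div, inv_mul_cancel₀ hn0'.ne', ENNReal.rpow_one,
      ENNReal.rpow_natCast] at h3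
  exact_mod_cast h2

theorem map_exp_ofReal (L : Matrix (Fin r) (Fin r) ℝ) :
    (NormedSpace.exp L).map (algebraMap ℝ ℂ) = NormedSpace.exp (L.map (algebraMap ℝ ℂ)) := by
  let _ : NormedAlgebra ℚ (Matrix (Fin r) (Fin r) ℝ) := NormedAlgebra.restrictScalars ℚ ℝ _
  exact NormedSpace.map_exp (RingHom.mapMatrix (algebraMap ℝ ℂ) :
    Matrix (Fin r) (Fin r) ℝ →+* Matrix (Fin r) (Fin r) ℂ)
    (Continuous.matrix_map continuous_id Complex.continuous_ofReal) L

theorem IsHurwitz.tendsto_exp_pow {L : Matrix (Fin r) (Fin r) ℝ} (hL : IsHurwitz L) :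
    Tendsto (fun n : ℕ => NormedSpace.exp L ^ n) atTop (𝓝 0) := by
  rcases isEmpty_or_nonempty (Fin r) with hr | hr
  · exact tendsto_const_nhds.congr fun n => Subsingleton.elim _ _
  have hC : Tendsto (fun n : ℕ => NormedSpace.exp (L.map (algebraMap ℝ ℂ)) ^ n) atTop (𝓝 0) := by
    refine tendsto_pow_of_spectralRadius_lt_one ?_
    refine spectrum.spectralRadius_lt_of_forall_lt (r := 1) _ fun μ hμ => ?_
    obtain ⟨z, hz, rfl⟩ := exists_exp_eq_of_mem_spectrum_exp hμ
    have : ‖Complex.exp z‖ < 1 := by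
      rw [Complex.norm_exp, Real.exp_lt_one_iff]
      exact hL z hz
    exact_mod_cast this
  have hre : Continuous fun C : Matrix (Fin r) (Fin r) ℂ => C.map Complex.re :=
    Continuous.matrix_map continuous_id Complex.continuous_re
  have h0 := (hre.tendsto 0).comp hC
  have h00 : (0 : Matrix (Fin r) (Fin r) ℂ).map Complex.re = 0 := by ext; simp
  rw [h00] at h0
  refine h0.congr fun n => ?_
  rw [Function.comp_apply, ← map_exp_ofReal]
  have : ((NormedSpace.exp L).map (algebraMap ℝ ℂ)) ^ n
      = ((NormedSpace.exp L) ^ n).map (algebraMap ℝ ℂ) :=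
    (map_pow (RingHom.mapMatrix (algebraMap ℝ ℂ)) (NormedSpace.exp L) n).symm
  rw [this]
  ext i j
  simp

/-! ### Sylvester and Lyapunov equations -/

theorem hasDerivAt_exp_mul_mul_exp (L M X : Matrix (Fin r) (Fin r) ℝ) (t : ℝ) :
    HasDerivAt (fun u : ℝ => NormedSpace.exp (u • L) * X * NormedSpace.exp (u • M))
      (NormedSpace.exp (t • L) * (L * X + X * M) * NormedSpace.exp (t • M)) t := by
  have h := ((hasDerivAt_exp_smul_const L t).mul_const X).mul (hasDerivAt_exp_smul_const' M t)
  refine h.congr_deriv ?_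
  noncomm_ring

theorem tendsto_exp_mul_mul_exp {L M : Matrix (Fin r) (Fin r) ℝ} (hL : IsHurwitz L)
    (hM : IsHurwitz M) (X : Matrix (Fin r) (Fin r) ℝ) :
    Tendsto (fun n : ℕ => NormedSpace.exp ((n : ℝ) • L) * X * NormedSpace.exp ((n : ℝ) • M))
      atTop (𝓝 0) := by
  have h := (hL.tendsto_exp_pow.mul_const X).mul hM.tendsto_exp_pow
  rw [mul_zero] at h
  refine h.congr fun n => ?_
  rw [Nat.cast_smul_eq_nsmul, Nat.cast_smul_eq_nsmul, Matrix.exp_nsmul, Matrix.exp_nsmul]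

/-- The function `t ↦ e^{tL} X e^{tM}` is constant, equals `X` at `0`, and tends to `0` along the
integers. -/
theorem eq_zero_of_sylvester {L M X : Matrix (Fin r) (Fin r) ℝ} (hL : IsHurwitz L)
    (hM : IsHurwitz M) (h : L * X + X * M = 0) : X = 0 := by
  have hconst : ∀ t : ℝ, NormedSpace.exp (t • L) * X * NormedSpace.exp (t • M) = X := fun t => by
    have := is_const_of_deriv_eq_zero
      (fun u => (hasDerivAt_exp_mul_mul_exp L M X u).differentiableAt)
      (fun u => by rw [(hasDerivAt_exp_mul_mul_exp L M X u).deriv, h]; simp) t 0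
    simpa using this
  have hlim := tendsto_exp_mul_mul_exp hL hM X
  simp only [hconst] at hlim
  exact tendsto_nhds_unique tendsto_const_nhds hlim

theorem transpose_eq_of_lyapunov {M X Q : Matrix (Fin r) (Fin r) ℝ} (hM : IsHurwitz M)
    (hQ : Qᵀ = Q) (h : Mᵀ * X + X * M = -Q) : Xᵀ = X := by
  refine sub_eq_zero.1 (eq_zero_of_sylvester hM.transpose hM ?_)
  have ht := congrArg Matrix.transpose h
  simp only [Matrix.transpose_add, Matrix.transpose_mul, Matrix.transpose_transpose,
    Matrix.transpose_neg, hQ] at ht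
  rw [mul_sub, sub_mul, sub_add_sub_comm, add_comm (Mᵀ * Xᵀ), ht, h, sub_self]

theorem transpose_eq_of_posSemidef {Q : Matrix (Fin r) (Fin r) ℝ} (hQ : Q.PosSemidef) : Qᵀ = Q := by
  rw [← Matrix.conjTranspose_eq_transpose_of_trivial]; exact hQ.isHermitian

theorem exp_smul_transpose (M : Matrix (Fin r) (Fin r) ℝ) (t : ℝ) :
    NormedSpace.exp (t • Mᵀ) = (NormedSpace.exp (t • M))ᵀ := by
  rw [← Matrix.exp_transpose, Matrix.transpose_smul]

theorem posSemidef_exp_conj {Q : Matrix (Fin r) (Fin r) ℝ} (hQ : Q.PosSemidef)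
    (M : Matrix (Fin r) (Fin r) ℝ) (t : ℝ) :
    (NormedSpace.exp (t • Mᵀ) * Q * NormedSpace.exp (t • M)).PosSemidef := by
  rw [exp_smul_transpose]
  simpa using hQ.conjTranspose_mul_mul_same (NormedSpace.exp (t • M))

theorem hasDerivAt_dotProduct_mulVec {F : ℝ → Matrix (Fin r) (Fin r) ℝ}
    {F' : Matrix (Fin r) (Fin r) ℝ} {t : ℝ} (h : HasDerivAt F F' t) (x y : Fin r → ℝ) :
    HasDerivAt (fun u => x ⬝ᵥ (F u *ᵥ y)) (x ⬝ᵥ (F' *ᵥ y)) t := by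
  let φ : Matrix (Fin r) (Fin r) ℝ →ₗ[ℝ] ℝ :=
    { toFun := fun N => x ⬝ᵥ (N *ᵥ y)
      map_add' := fun N K => by rw [Matrix.add_mulVec, dotProduct_add]
      map_smul' := fun c N => by rw [Matrix.smul_mulVec, dotProduct_smul]; rfl }
  exact (LinearMap.toContinuousLinearMap φ).hasFDerivAt.comp_hasDerivAt t h

/-- The quadratic forms of `e^{tMᵀ} X e^{tM}` decrease in `t`, from that of `X` to `0`. -/
theorem posSemidef_of_lyapunov {M X Q : Matrix (Fin r) (Fin r) ℝ} (hM : IsHurwitz M)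
    (hQ : Q.PosSemidef) (h : Mᵀ * X + X * M = -Q) : X.PosSemidef := by
  have hX := transpose_eq_of_lyapunov hM (transpose_eq_of_posSemidef hQ) h
  refine Matrix.PosSemidef.of_dotProduct_mulVec_nonneg
    (by rw [Matrix.IsHermitian, Matrix.conjTranspose_eq_transpose_of_trivial, hX]) fun x => ?_
  rw [star_trivial]
  set f : ℝ → ℝ := fun t =>
    x ⬝ᵥ ((NormedSpace.exp (t • Mᵀ) * X * NormedSpace.exp (t • M)) *ᵥ x) with hf
  have hder : ∀ t, HasDerivAt f
      (x ⬝ᵥ ((NormedSpace.exp (t • Mᵀ) * (-Q) * NormedSpace.exp (t • M)) *ᵥ x)) t := fun t => by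
    have := hasDerivAt_dotProduct_mulVec (hasDerivAt_exp_mul_mul_exp Mᵀ M X t) x x
    rwa [h] at this
  have hanti : Antitone f := by
    refine antitone_of_deriv_nonpos (fun t => (hder t).differentiableAt) fun t => ?_
    rw [(hder t).deriv, mul_neg, neg_mul, Matrix.neg_mulVec, dotProduct_neg]
    have := (posSemidef_exp_conj hQ M t).dotProduct_mulVec_nonneg x
    rw [star_trivial] at this
    linarith
  have hlim : Tendsto (fun n : ℕ => f n) atTop (𝓝 0) := by
    have hc : Continuous fun N : Matrix (Fin r) (Fin r) ℝ => x ⬝ᵥ (N *ᵥ x) := by fun_prop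
    have := (hc.tendsto 0).comp (tendsto_exp_mul_mul_exp hM.transpose hM X)
    rw [Matrix.zero_mulVec, dotProduct_zero] at this
    exact this
  have h0 : f 0 = x ⬝ᵥ (X *ᵥ x) := by simp [hf]
  rw [← h0]
  exact le_of_tendsto' hlim fun n => hanti (Nat.cast_nonneg n)

/-- In finite dimension, uniqueness for the Sylvester equation gives solvability. -/
theorem exists_lyapunov {M : Matrix (Fin r) (Fin r) ℝ} (hM : IsHurwitz M)
    (Q : Matrix (Fin r) (Fin r) ℝ) : ∃ X, Mᵀ * X + X * M = -Q := by
  let T : Matrix (Fin r) (Fin r) ℝ →ₗ[ℝ] Matrix (Fin r) (Fin r) ℝ :=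
    LinearMap.mulLeft ℝ Mᵀ + LinearMap.mulRight ℝ M
  have hT : Function.Injective T := by
    rw [← LinearMap.ker_eq_bot, LinearMap.ker_eq_bot']
    exact fun X hX => eq_zero_of_sylvester hM.transpose hM hX
  exact LinearMap.injective_iff_surjective.1 hT (-Q)

/-! ### The algebraic Riccati equation -/

/-- Monotone convergence for matrices: quadratic forms converge, and the entries follow by
polarization. -/
theorem exists_tendsto_of_antitone_posSemidef {P : ℕ → Matrix (Fin r) (Fin r) ℝ}
    (hP : ∀ n, (P n).PosSemidef) (hanti : ∀ n, (P n - P (n + 1)).PosSemidef) :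
    ∃ X, Tendsto P atTop (𝓝 X) := by
  have hq : ∀ x : Fin r → ℝ, ∃ l, Tendsto (fun n => x ⬝ᵥ (P n *ᵥ x)) atTop (𝓝 l) := by
    intro x
    refine ⟨_, tendsto_atTop_ciInf (antitone_nat_of_succ_le fun n => ?_) ⟨0, ?_⟩⟩
    · have := (hanti n).dotProduct_mulVec_nonneg x
      rw [star_trivial, Matrix.sub_mulVec, dotProduct_sub] at this
      linarith
    · rintro _ ⟨n, rfl⟩
      simpa using (hP n).dotProduct_mulVec_nonneg x
  have hb : ∀ i j, ∃ l, Tendsto (fun n => P n i j) atTop (𝓝 l) := by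
    intro i j
    obtain ⟨a, ha⟩ := hq (Pi.single i 1 + Pi.single j 1)
    obtain ⟨b, hb⟩ := hq (Pi.single i 1)
    obtain ⟨c, hc⟩ := hq (Pi.single j 1)
    refine ⟨(a - b - c) / 2, (((ha.sub hb).sub hc).div_const 2).congr fun n => ?_⟩
    have hs : P n j i = P n i j := congrFun (congrFun (transpose_eq_of_posSemidef (hP n)) i) j
    simp only [Matrix.mulVec_add, add_dotProduct, dotProduct_add, Matrix.mulVec_single_one,
      single_one_dotProduct, Matrix.col_apply, hs]
    ring
  choose l hl using hb
  exact ⟨Matrix.of l, tendsto_pi_nhds.2 fun i => tendsto_pi_nhds.2 fun j => hl i j⟩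

/-- Bass' stabilization: for large `β` the matrix `-(A + β)` is Hurwitz, so that
`(A + β)ᵀ W + W (A + β) = S` has a solution `W`, positive definite by observability, and
`(A - W⁻¹S)ᵀ W + W (A - W⁻¹S) = -(S + 2βW)` is negative definite. -/
theorem exists_isHurwitz_sub_mul {A S : Matrix (Fin r) (Fin r) ℝ} (hS : S.PosSemidef)
    (hAS : NoInvariantKer A S) : ∃ P, Pᵀ = P ∧ IsHurwitz (A - P * S) := by
  set β : ℝ := ‖A.map (algebraMap ℝ ℂ)‖ + 1 with hβ
  have hβ0 : 0 < β := by positivity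
  set M : Matrix (Fin r) (Fin r) ℝ := -(A + β • 1) with hM
  have hMH : IsHurwitz M := by
    intro z hz
    obtain ⟨v, hv, h⟩ := exists_mulVec_eq_smul_of_mem_spectrum hz
    have hmap : M.map (algebraMap ℝ ℂ) = -(A.map (algebraMap ℝ ℂ) + (β : ℂ) • 1) := by
      ext i j
      rcases eq_or_ne i j with rfl | hij
      · simp [hM]
      · simp [hM, hij]
    rw [hmap, Matrix.neg_mulVec, Matrix.add_mulVec, Matrix.smul_mulVec, Matrix.one_mulVec] at h
    have hA : A.map (algebraMap ℝ ℂ) *ᵥ v = (-(z + β)) • v := by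
      rw [neg_smul, add_smul, ← h]; abel
    have hmem := mem_spectrum_of_mulVec_eq_smul hv hA
    have : Nonempty (Fin r) := by
      by_contra hne
      rw [not_nonempty_iff] at hne
      exact hv (Subsingleton.elim _ _)
    -- an eigenvalue `z` of `-(A + β)` gives the eigenvalue `-(z + β)` of `A`, bounded by `‖A‖ = β - 1`
    have hn := spectrum.norm_le_norm_of_mem hmem
    have hre := Complex.abs_re_le_norm (-(z + β))
    simp only [Complex.neg_re, Complex.add_re, Complex.ofReal_re] at hre
    have := neg_abs_le (-(z.re + β))
    have := abs_le.1 (hre.trans hn)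
    linarith
  obtain ⟨W, hW⟩ := exists_lyapunov hMH S
  have hWp := posSemidef_of_lyapunov hMH hS hW
  have hWd : W.PosDef := by
    refine (posDef_and_isHurwitz_of_lyapunov hWp hS hW fun U hU hUS => ?_).1
    refine hAS U (fun x hx => ?_) hUS
    have h1 : A *ᵥ x = -(M *ᵥ x) - β • x := by
      rw [hM, Matrix.neg_mulVec, Matrix.add_mulVec, Matrix.smul_mulVec, Matrix.one_mulVec]; abel
    rw [h1]
    exact sub_mem (neg_mem (hU x hx)) (U.smul_mem β hx)
  have hu : IsUnit W.det := (Matrix.isUnit_iff_isUnit_det W).1 hWd.isUnit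
  have hWi : (W⁻¹)ᵀ = W⁻¹ := transpose_eq_of_posSemidef hWd.inv.posSemidef
  refine ⟨W⁻¹, hWi, ?_⟩
  have hQd : (S + (2 * β) • W).PosDef :=
    Matrix.PosDef.posSemidef_add hS (hWd.smul (by positivity))
  refine (posDef_and_isHurwitz_of_lyapunov (Q := S + (2 * β) • W) hWp hQd.posSemidef ?_
    fun U _ hUQ => ?_).2
  · have hSt := transpose_eq_of_posSemidef hS
    have hly : Aᵀ * W + W * A = S - (2 * β) • W := by
      rw [hM] at hW
      simp only [Matrix.transpose_neg, Matrix.transpose_add, Matrix.transpose_smul,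
        Matrix.transpose_one, neg_mul, mul_neg, add_mul, mul_add, Matrix.smul_mul,
        Matrix.mul_smul, one_mul, mul_one] at hW
      rw [← sub_eq_zero] at hW ⊢
      rw [← neg_eq_zero, ← hW, two_mul, add_smul]
      abel
    rw [Matrix.transpose_sub, Matrix.transpose_mul, hWi, hSt, sub_mul, mul_sub, mul_assoc,
      Matrix.nonsing_inv_mul W hu, ← mul_assoc W, Matrix.mul_nonsing_inv W hu, mul_one, one_mul]
    have : Aᵀ * W - S + (W * A - S) = (Aᵀ * W + W * A) - S - S := by abel
    rw [this, hly]
    abel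
  · rw [Submodule.eq_bot_iff]
    intro x hx
    by_contra h0
    have := hQd.dotProduct_mulVec_pos h0
    rw [hUQ x hx, dotProduct_zero] at this
    exact lt_irrefl _ this

theorem posSemidef_symm_conj {S P : Matrix (Fin r) (Fin r) ℝ} (hS : S.PosSemidef) (hP : Pᵀ = P) :
    (P * S * P).PosSemidef := by
  have := hS.conjTranspose_mul_mul_same P
  rwa [Matrix.conjTranspose_eq_transpose_of_trivial, hP] at this

theorem mulVec_eq_zero_of_add {Q₁ Q₂ : Matrix (Fin r) (Fin r) ℝ} (h₁ : Q₁.PosSemidef)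
    (h₂ : Q₂.PosSemidef) {x : Fin r → ℝ} (h : (Q₁ + Q₂) *ᵥ x = 0) :
    Q₁ *ᵥ x = 0 ∧ Q₂ *ᵥ x = 0 := by
  have h0 : star x ⬝ᵥ (Q₁ *ᵥ x) + star x ⬝ᵥ (Q₂ *ᵥ x) = 0 := by
    rw [← dotProduct_add, ← Matrix.add_mulVec, h, dotProduct_zero]
  have := h₁.dotProduct_mulVec_nonneg x
  have := h₂.dotProduct_mulVec_nonneg x
  exact ⟨(h₁.dotProduct_mulVec_zero_iff x).1 (by linarith),
    (h₂.dotProduct_mulVec_zero_iff x).1 (by linarith)⟩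

theorem mulVec_eq_zero_of_conj {S P : Matrix (Fin r) (Fin r) ℝ} (hS : S.PosSemidef) (hP : Pᵀ = P)
    {x : Fin r → ℝ} (h : (P * S * P) *ᵥ x = 0) : S *ᵥ (P *ᵥ x) = 0 := by
  refine (hS.dotProduct_mulVec_zero_iff _).1 ?_
  rw [star_trivial, dotProduct_mulVec_symm hP, dotProduct_comm, Matrix.mulVec_mulVec,
    Matrix.mulVec_mulVec, h, dotProduct_zero]

theorem transpose_sub_mul {A S P : Matrix (Fin r) (Fin r) ℝ} (hS : Sᵀ = S) (hP : Pᵀ = P) :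
    (A - P * S)ᵀ = Aᵀ - S * P := by
  rw [Matrix.transpose_sub, Matrix.transpose_mul, hS, hP]

/-- The Lyapunov criterion for the dual closed loop `(A - PS)ᵀ`, which agrees with `Aᵀ` on the kernel
of `R + PSP + D`. The term `D` is the quadratic defect of a Newton step and vanishes at a solution of the
algebraic Riccati equation. -/
theorem posDef_and_isHurwitz_of_controllable {A R S P D : Matrix (Fin r) (Fin r) ℝ}
    (hR : R.PosSemidef) (hS : S.PosSemidef) (hAR : NoInvariantKer Aᵀ R) (hP : P.PosSemidef)
    (hD : D.PosSemidef)
    (h : (A - P * S) * P + P * (A - P * S)ᵀ = -(R + P * S * P + D)) :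
    P.PosDef ∧ IsHurwitz (A - P * S) := by
  have hPt := transpose_eq_of_posSemidef hP
  have hSt := transpose_eq_of_posSemidef hS
  have hPSP := posSemidef_symm_conj hS hPt
  have hno : NoInvariantKer (A - P * S)ᵀ (R + P * S * P + D) := by
    refine hAR.of_ker fun x hx => ?_
    obtain ⟨hx1, -⟩ := mulVec_eq_zero_of_add (hR.add hPSP) hD hx
    obtain ⟨hx2, hx3⟩ := mulVec_eq_zero_of_add hR hPSP hx1
    refine ⟨hx2, ?_⟩
    rw [transpose_sub_mul hSt hPt, Matrix.sub_mulVec, ← Matrix.mulVec_mulVec,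
      mulVec_eq_zero_of_conj hS hPt hx3, sub_zero]
  have := posDef_and_isHurwitz_of_lyapunov (M := (A - P * S)ᵀ) hP ((hR.add hPSP).add hD)
    (by rw [Matrix.transpose_transpose]; exact h) hno
  refine ⟨this.1, ?_⟩
  simpa using this.2.transpose

/-- One Newton step from a stabilizing `P` produces a positive semidefinite stabilizing `P'`. -/
theorem newton_step {A R S P : Matrix (Fin r) (Fin r) ℝ}
    (hR : R.PosSemidef) (hS : S.PosSemidef) (hAR : NoInvariantKer Aᵀ R) (hP : Pᵀ = P)
    (hPH : IsHurwitz (A - P * S)) :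
    ∃ P' : Matrix (Fin r) (Fin r) ℝ, P'.PosSemidef ∧ IsHurwitz (A - P' * S) ∧
      (A - P * S) * P' + P' * (A - P * S)ᵀ = -(R + P * S * P) := by
  have hQ := hR.add (posSemidef_symm_conj hS hP)
  obtain ⟨P', h⟩ := exists_lyapunov hPH.transpose (R + P * S * P)
  have hP' := posSemidef_of_lyapunov hPH.transpose hQ h
  rw [Matrix.transpose_transpose] at h
  refine ⟨P', hP', ?_, h⟩
  have hPt' := transpose_eq_of_posSemidef hP'
  have hSt := transpose_eq_of_posSemidef hS
  refine (posDef_and_isHurwitz_of_controllable (D := (P - P') * S * (P - P')) hR hS hAR hP'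
    (posSemidef_symm_conj hS (by rw [Matrix.transpose_sub, hP, hPt'])) ?_).2
  rw [transpose_sub_mul hSt hP] at h
  rw [transpose_sub_mul hSt hPt']
  have h2 : (A - P' * S) * P' + P' * (Aᵀ - S * P') = ((A - P * S) * P' + P' * (Aᵀ - S * P))
    + (P - P') * S * P' + P' * S * (P - P') := by noncomm_ring
  rw [h2, h]
  noncomm_ring

/-- The difference of two consecutive Newton iterates solves a Lyapunov equation with the positive
semidefinite right-hand side `(P - P')S(P - P')`. -/
theorem newton_antitone {A R S P P' P'' : Matrix (Fin r) (Fin r) ℝ} (hS : S.PosSemidef)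
    (hP : Pᵀ = P) (hP' : P'ᵀ = P') (hPH : IsHurwitz (A - P' * S))
    (h : (A - P * S) * P' + P' * (A - P * S)ᵀ = -(R + P * S * P))
    (h' : (A - P' * S) * P'' + P'' * (A - P' * S)ᵀ = -(R + P' * S * P')) :
    (P' - P'').PosSemidef := by
  have hSt := transpose_eq_of_posSemidef hS
  refine posSemidef_of_lyapunov (M := (A - P' * S)ᵀ) (Q := (P - P') * S * (P - P')) hPH.transpose
    (posSemidef_symm_conj hS (by rw [Matrix.transpose_sub, hP, hP'])) ?_
  rw [Matrix.transpose_transpose]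
  rw [transpose_sub_mul hSt hP] at h
  rw [transpose_sub_mul hSt hP'] at h' ⊢
  have h2 : (A - P' * S) * (P' - P'') + (P' - P'') * (Aᵀ - S * P')
    = ((A - P * S) * P' + P' * (Aᵀ - S * P)) + (P - P') * S * P' + P' * S * (P - P')
      - ((A - P' * S) * P'' + P'' * (Aᵀ - S * P')) := by noncomm_ring
  rw [h2, h, h']
  noncomm_ring

/-- The Newton iterates decrease to a stabilizing solution of the algebraic Riccati equation. -/
theorem exists_isStabilizing {A R S : Matrix (Fin r) (Fin r) ℝ}
    (hR : R.PosSemidef) (hS : S.PosSemidef) (hAR : NoInvariantKer Aᵀ R)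
    (hAS : NoInvariantKer A S) : ∃ P, IsStabilizing A R S P := by
  have hSt := transpose_eq_of_posSemidef hS
  obtain ⟨P₀, hP₀, hP₀H⟩ := exists_isHurwitz_sub_mul hS hAS
  choose! step hstep using fun P (hP : Pᵀ = P ∧ IsHurwitz (A - P * S)) =>
    newton_step hR hS hAR hP.1 hP.2
  let seq : ℕ → Matrix (Fin r) (Fin r) ℝ := fun n => step^[n] P₀
  have hsucc : ∀ n, seq (n + 1) = step (seq n) := fun n => Function.iterate_succ_apply' step n P₀
  have hseq : ∀ n, (seq n)ᵀ = seq n ∧ IsHurwitz (A - seq n * S) := by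
    intro n
    induction n with
    | zero => exact ⟨hP₀, hP₀H⟩
    | succ n ih =>
      rw [hsucc]
      exact ⟨transpose_eq_of_posSemidef (hstep _ ih).1, (hstep _ ih).2.1⟩
  have hpsd : ∀ n, (seq (n + 1)).PosSemidef := fun n => by
    rw [hsucc]; exact (hstep _ (hseq n)).1
  have heq : ∀ n, (A - seq n * S) * seq (n + 1) + seq (n + 1) * (A - seq n * S)ᵀ
      = -(R + seq n * S * seq n) := fun n => by
    rw [hsucc]; exact (hstep _ (hseq n)).2.2
  -- the initial `P₀` need not be positive semidefinite: monotonicity starts at the first iterate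
  obtain ⟨P, hP⟩ := exists_tendsto_of_antitone_posSemidef (P := fun n => seq (n + 1)) hpsd
    fun n => newton_antitone hS (hseq n).1 (hseq (n + 1)).1 (hseq (n + 1)).2 (heq n) (heq (n + 1))
  have hP' : Tendsto seq atTop (𝓝 P) := (tendsto_add_atTop_iff_nat 1).1 hP
  have hPpsd : P.PosSemidef := by
    refine Matrix.PosSemidef.of_dotProduct_mulVec_nonneg ?_ fun x => ?_
    · have h1 : Tendsto (fun n => (seq n)ᵀ) atTop (𝓝 Pᵀ) :=
        (Continuous.matrix_transpose continuous_id).tendsto P |>.comp hP'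
      simp only [(hseq _).1] at h1
      rw [Matrix.IsHermitian, Matrix.conjTranspose_eq_transpose_of_trivial]
      exact tendsto_nhds_unique h1 hP'
    · have hc : Continuous fun N : Matrix (Fin r) (Fin r) ℝ => star x ⬝ᵥ (N *ᵥ x) := by fun_prop
      exact ge_of_tendsto' ((hc.tendsto P).comp hP) fun n => (hpsd n).dotProduct_mulVec_nonneg x
  have hlim : (A - P * S) * P + P * (A - P * S)ᵀ = -(R + P * S * P) := by
    have hc : Continuous fun N : Matrix (Fin r) (Fin r) ℝ × Matrix (Fin r) (Fin r) ℝ =>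
        (A - N.1 * S) * N.2 + N.2 * (A - N.1 * S)ᵀ := by fun_prop
    have hc' : Continuous fun N : Matrix (Fin r) (Fin r) ℝ => -(R + N * S * N) := by fun_prop
    refine tendsto_nhds_unique ((hc.tendsto (P, P)).comp (hP'.prodMk_nhds hP)) ?_
    refine ((hc'.tendsto P).comp hP').congr fun n => (heq n).symm
  have hPt := transpose_eq_of_posSemidef hPpsd
  obtain ⟨h1, h2⟩ := posDef_and_isHurwitz_of_controllable (D := 0) hR hS hAR hPpsd
    Matrix.PosSemidef.zero (by rw [hlim, add_zero])
  refine ⟨P, h1, ?_, h2⟩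
  rw [transpose_sub_mul hSt hPt] at hlim
  have h3 : drift A R S P = ((A - P * S) * P + P * (Aᵀ - S * P)) + (R + P * S * P) := by
    rw [drift]; noncomm_ring
  rw [h3, hlim, neg_add_cancel]

/-- The difference `P₁ - P₂` satisfies `(A - P₁S)(P₁ - P₂) + (P₁ - P₂)(A - P₂S)ᵀ = 0`. -/
theorem IsStabilizing.unique {A R S P₁ P₂ : Matrix (Fin r) (Fin r) ℝ} (hS : Sᵀ = S)
    (h₁ : IsStabilizing A R S P₁) (h₂ : IsStabilizing A R S P₂) : P₁ = P₂ := by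
  have hP₂ := transpose_eq_of_posSemidef h₂.1.posSemidef
  refine sub_eq_zero.1 (eq_zero_of_sylvester h₁.2.2 h₂.2.2.transpose ?_)
  rw [transpose_sub_mul hS hP₂]
  have h3 : (A - P₁ * S) * (P₁ - P₂) + (P₁ - P₂) * (Aᵀ - S * P₂)
    = drift A R S P₁ - drift A R S P₂ := by rw [drift, drift]; noncomm_ring
  rw [h3, h₁.2.1, h₂.2.1, sub_zero]

/-! ### Uniqueness of solutions -/

/-- Uniqueness on `[0, ∞)` for an autonomous equation with a `C¹` vector field: on `[0, t]` both
solutions stay in a compact set, where the field is Lipschitz. -/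
theorem eq_of_hasDerivWithinAt_Ici {E : Type*} [NormedAddCommGroup E] [NormedSpace ℝ E]
    {v : E → E} (hv : ContDiff ℝ 1 v) {f g : ℝ → E}
    (hf : ∀ t : ℝ, 0 ≤ t → HasDerivWithinAt f (v (f t)) (Set.Ici 0) t)
    (hg : ∀ t : ℝ, 0 ≤ t → HasDerivWithinAt g (v (g t)) (Set.Ici 0) t)
    (h0 : f 0 = g 0) {t : ℝ} (ht : 0 ≤ t) : f t = g t := by
  have hfc : ContinuousOn f (Set.Icc 0 t) := fun u hu =>
    (hf u hu.1).continuousWithinAt.mono Set.Icc_subset_Ici_self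
  have hgc : ContinuousOn g (Set.Icc 0 t) := fun u hu =>
    (hg u hu.1).continuousWithinAt.mono Set.Icc_subset_Ici_self
  obtain ⟨K, hK⟩ := LocallyLipschitzOn.exists_lipschitzOnWith_of_compact
    ((isCompact_Icc.image_of_continuousOn hfc).union (isCompact_Icc.image_of_continuousOn hgc))
    hv.locallyLipschitz.locallyLipschitzOn
  refine ODE_solution_unique_of_mem_Icc_right (v := fun _ => v) (fun _ _ => hK) hfc
    (fun u hu => (hf u hu.1).mono (Set.Ici_subset_Ici.2 hu.1))
    (fun u hu => Or.inl (Set.mem_image_of_mem f (Set.Ico_subset_Icc_self hu))) hgc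
    (fun u hu => (hg u hu.1).mono (Set.Ici_subset_Ici.2 hu.1))
    (fun u hu => Or.inr (Set.mem_image_of_mem g (Set.Ico_subset_Icc_self hu))) h0
    (Set.right_mem_Icc.2 ht)

theorem IsSolution.unique {A R S Q : Matrix (Fin r) (Fin r) ℝ}
    {P₁ P₂ : ℝ → Matrix (Fin r) (Fin r) ℝ} (h₁ : IsSolution A R S Q P₁)
    (h₂ : IsSolution A R S Q P₂) {t : ℝ} (ht : 0 ≤ t) : P₁ t = P₂ t := by
  refine eq_of_hasDerivWithinAt_Ici (v := drift A R S) ?_ h₁.2 h₂.2 (h₁.1.trans h₂.1.symm) ht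
  unfold drift
  fun_prop

/-! ### Derivative of the inverse -/

theorem hasDerivAt_matrix_inv {F : ℝ → Matrix (Fin r) (Fin r) ℝ}
    {F' : Matrix (Fin r) (Fin r) ℝ} {t : ℝ} (h : HasDerivAt F F' t) (hu : IsUnit (F t)) :
    HasDerivAt (fun u => (F u)⁻¹) (-((F t)⁻¹ * F' * (F t)⁻¹)) t := by
  obtain ⟨x, hx⟩ := hu
  have h1 := hasFDerivAt_ringInverse (𝕜 := ℝ) x
  rw [hx] at h1
  have h2 := h1.comp_hasDerivAt t h
  simp only [Matrix.nonsing_inv_eq_ringInverse]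
  refine h2.congr_deriv ?_
  rw [← hx, Ring.inverse_unit]
  simp

/-! ### The Gramian -/

theorem continuous_gramIntegrand (A R S : Matrix (Fin r) (Fin r) ℝ) :
    Continuous (gramIntegrand A R S) :=
  continuous_iff_continuousAt.2 fun t => (hasDerivAt_exp_mul_mul_exp _ _ S t).continuousAt

theorem hasDerivAt_gram (A R S : Matrix (Fin r) (Fin r) ℝ) (t : ℝ) :
    HasDerivAt (gram A R S) (gramIntegrand A R S t) t :=
  (continuous_gramIntegrand A R S).integral_hasStrictDerivAt 0 t |>.hasDerivAt

theorem gram_zero (A R S : Matrix (Fin r) (Fin r) ℝ) : gram A R S 0 = 0 :=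
  intervalIntegral.integral_same

theorem gramIntegrand_posSemidef {A R S : Matrix (Fin r) (Fin r) ℝ} (hS : S.PosSemidef) (t : ℝ) :
    (gramIntegrand A R S t).PosSemidef := posSemidef_exp_conj hS _ t

theorem gram_transpose {A R S : Matrix (Fin r) (Fin r) ℝ} (hS : S.PosSemidef) (t : ℝ) :
    (gram A R S t)ᵀ = gram A R S t := by
  let T : Matrix (Fin r) (Fin r) ℝ →L[ℝ] Matrix (Fin r) (Fin r) ℝ :=
    LinearMap.toContinuousLinearMap (Matrix.transposeLinearEquiv (Fin r) (Fin r) ℝ ℝ).toLinearMap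
  have h := T.intervalIntegral_comp_comm
    ((continuous_gramIntegrand A R S).intervalIntegrable (μ := volume) 0 t)
  have hT : ∀ s, T (gramIntegrand A R S s) = gramIntegrand A R S s := fun s =>
    transpose_eq_of_posSemidef (gramIntegrand_posSemidef hS s)
  simp only [hT] at h
  exact h.symm

theorem monotone_dotProduct_gram {A R S : Matrix (Fin r) (Fin r) ℝ} (hS : S.PosSemidef)
    (x : Fin r → ℝ) : Monotone fun t => x ⬝ᵥ (gram A R S t *ᵥ x) := by
  have hd := fun t => hasDerivAt_dotProduct_mulVec (hasDerivAt_gram A R S t) x x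
  refine monotone_of_deriv_nonneg (fun t => (hd t).differentiableAt) fun t => ?_
  rw [(hd t).deriv]
  simpa using (gramIntegrand_posSemidef hS t).dotProduct_mulVec_nonneg x

/-- If the quadratic form of `𝕊_t` vanishes at `x`, then `S e^{sB} x = 0` for `0 < s < t`. The vectors
with this property form a `B`-invariant subspace of `ker S`. -/
theorem gram_posDef {A R S : Matrix (Fin r) (Fin r) ℝ} (hS : S.PosSemidef)
    (hAS : NoInvariantKer A S) {t : ℝ} (ht : 0 < t) : (gram A R S t).PosDef := by
  set B := closedLoop A R S with hB
  have hBS : NoInvariantKer B S := hAS.of_ker fun x hx => ⟨hx, by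
    rw [hB, closedLoop, Matrix.sub_mulVec, ← Matrix.mulVec_mulVec, hx, Matrix.mulVec_zero,
      sub_zero]⟩
  refine Matrix.PosDef.of_dotProduct_mulVec_pos
    (by rw [Matrix.IsHermitian, Matrix.conjTranspose_eq_transpose_of_trivial,
      gram_transpose hS]) fun x hx => ?_
  rw [star_trivial]
  have hmono := monotone_dotProduct_gram (A := A) (R := R) hS x
  have hzero : x ⬝ᵥ (gram A R S 0 *ᵥ x) = 0 := by simp [gram_zero]
  have hge := hmono ht.le
  simp only [hzero] at hge
  refine lt_of_le_of_ne hge fun heq => hx ?_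
  have hSx : ∀ s ∈ Set.Ioo 0 t, S *ᵥ (NormedSpace.exp (s • B) *ᵥ x) = 0 := by
    intro s hs
    have hd := hasDerivAt_dotProduct_mulVec (hasDerivAt_gram A R S s) x x
    have hev : (fun u => x ⬝ᵥ (gram A R S u *ᵥ x)) =ᶠ[𝓝 s] fun _ => (0 : ℝ) := by
      filter_upwards [Ioo_mem_nhds hs.1 hs.2] with u hu
      have h1 := hmono hu.1.le
      have h2 := hmono hu.2.le
      simp only at h1 h2
      linarith
    have h0 := hd.unique ((hasDerivAt_const s (0 : ℝ)).congr_of_eventuallyEq hev)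
    refine (hS.dotProduct_mulVec_zero_iff _).1 ?_
    rw [gramIntegrand, exp_smul_transpose, ← Matrix.mulVec_mulVec, ← Matrix.mulVec_mulVec,
      Matrix.dotProduct_mulVec, Matrix.vecMul_transpose] at h0
    rwa [star_trivial]
  let U : Submodule ℝ (Fin r → ℝ) :=
    { carrier := {y | ∀ s ∈ Set.Ioo 0 t, S *ᵥ (NormedSpace.exp (s • B) *ᵥ y) = 0}
      add_mem' := fun {a b} ha hb s hs => by
        rw [Matrix.mulVec_add, Matrix.mulVec_add, ha s hs, hb s hs, add_zero]
      zero_mem' := fun s _ => by rw [Matrix.mulVec_zero, Matrix.mulVec_zero]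
      smul_mem' := fun c a ha s hs => by
        rw [Matrix.mulVec_smul, Matrix.mulVec_smul, ha s hs, smul_zero] }
  have hderiv : ∀ (y w : Fin r → ℝ) (s : ℝ), HasDerivAt
      (fun u : ℝ => w ⬝ᵥ (S *ᵥ (NormedSpace.exp (u • B) *ᵥ y)))
      (w ⬝ᵥ (S *ᵥ (NormedSpace.exp (s • B) *ᵥ (B *ᵥ y)))) s := by
    intro y w s
    have := hasDerivAt_dotProduct_mulVec ((hasDerivAt_exp_smul_const B s).const_mul S) w y
    simpa only [← Matrix.mulVec_mulVec] using this
  have hU : U = ⊥ := by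
    refine hBS U (fun y hy s hs => ?_) fun y hy => ?_
    · refine (dotProduct_eq_zero_iff.1 fun w => ?_)
      rw [dotProduct_comm]
      have hev : (fun u : ℝ => w ⬝ᵥ (S *ᵥ (NormedSpace.exp (u • B) *ᵥ y)))
          =ᶠ[𝓝 s] fun _ => (0 : ℝ) := by
        filter_upwards [Ioo_mem_nhds hs.1 hs.2] with u hu
        rw [hy u hu, dotProduct_zero]
      exact (hderiv y w s).unique ((hasDerivAt_const s (0 : ℝ)).congr_of_eventuallyEq hev)
    · refine (dotProduct_eq_zero_iff.1 fun w => ?_)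
      rw [dotProduct_comm]
      have h1 := ((hderiv y w 0).continuousAt.tendsto).mono_left
        (nhdsWithin_le_nhds (s := Set.Ioi 0))
      have h2 : Tendsto (fun u : ℝ => w ⬝ᵥ (S *ᵥ (NormedSpace.exp (u • B) *ᵥ y)))
          (𝓝[>] 0) (𝓝 0) := by
        refine tendsto_const_nhds.congr' ?_
        filter_upwards [Ioo_mem_nhdsGT ht] with u hu
        rw [hy u hu, dotProduct_zero]
      have h3 := tendsto_nhds_unique h1 h2
      simpa using h3
  have hxU : x ∈ U := hSx
  rw [hU] at hxU
  simpa using hxU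

/-- The algebraic Riccati equation multiplied by `P_∞⁻¹` on both sides. -/
theorem steady_inv_lyapunov {A R S : Matrix (Fin r) (Fin r) ℝ} (hS : Sᵀ = S)
    (hst : IsStabilizing A R S (steady A R S)) :
    (closedLoop A R S)ᵀ * (steady A R S)⁻¹ + (steady A R S)⁻¹ * closedLoop A R S
      = -(S + (steady A R S)⁻¹ * R * (steady A R S)⁻¹) := by
  rw [closedLoop]
  set P := steady A R S
  have hPt := transpose_eq_of_posSemidef hst.1.posSemidef
  have hu : IsUnit P.det := (Matrix.isUnit_iff_isUnit_det P).1 hst.1.isUnit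
  rw [transpose_sub_mul hS hPt]
  have h1 := Matrix.mul_nonsing_inv P hu
  have h2 := Matrix.nonsing_inv_mul P hu
  have h3 : P⁻¹ * drift A R S P * P⁻¹ = 0 := by rw [hst.2.1]; simp
  have h4 : P⁻¹ * drift A R S P * P⁻¹ = P⁻¹ * A * (P * P⁻¹) + (P⁻¹ * P) * Aᵀ * P⁻¹
      + P⁻¹ * R * P⁻¹ - (P⁻¹ * P) * S * (P * P⁻¹) := by rw [drift]; noncomm_ring
  rw [h4, h1, h2, mul_one, mul_one, one_mul, one_mul] at h3
  have h5 : (Aᵀ - S * P) * P⁻¹ + P⁻¹ * (A - P * S)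
      = Aᵀ * P⁻¹ + P⁻¹ * A - S * (P * P⁻¹) - (P⁻¹ * P) * S := by noncomm_ring
  rw [h5, h1, h2, mul_one, one_mul, ← sub_eq_zero, ← h3]
  abel

/-- The bound `𝕊_t < P_∞⁻¹`. -/
theorem dotProduct_gram_lt {A R S : Matrix (Fin r) (Fin r) ℝ} (hR : R.PosSemidef)
    (hS : S.PosSemidef) (hst : IsStabilizing A R S (steady A R S)) {t : ℝ} (ht : 0 ≤ t)
    {x : Fin r → ℝ} (hx : x ≠ 0) :
    x ⬝ᵥ (gram A R S t *ᵥ x) < x ⬝ᵥ ((steady A R S)⁻¹ *ᵥ x) := by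
  have hly := steady_inv_lyapunov (transpose_eq_of_posSemidef hS) hst
  set B := closedLoop A R S with hB
  have hNd := hst.1.inv
  set N := (steady A R S)⁻¹ with hN
  have hNRN := posSemidef_symm_conj hR (transpose_eq_of_posSemidef hNd.posSemidef)
  have hd : ∀ u, HasDerivAt (fun u : ℝ => x ⬝ᵥ ((NormedSpace.exp (u • Bᵀ) * N *
      NormedSpace.exp (u • B) + gram A R S u) *ᵥ x))
      (-(x ⬝ᵥ ((NormedSpace.exp (u • Bᵀ) * (N * R * N) * NormedSpace.exp (u • B)) *ᵥ x))) u := by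
    intro u
    have h := hasDerivAt_dotProduct_mulVec
      ((hasDerivAt_exp_mul_mul_exp Bᵀ B N u).add (hasDerivAt_gram A R S u)) x x
    refine h.congr_deriv ?_
    rw [hly, gramIntegrand, ← dotProduct_neg, ← Matrix.neg_mulVec]
    congr 2
    noncomm_ring
  have hanti := antitone_of_deriv_nonpos (fun u => (hd u).differentiableAt) fun u => by
    rw [(hd u).deriv, neg_nonpos]
    simpa using (posSemidef_exp_conj hNRN B u).dotProduct_mulVec_nonneg x
  have h := hanti ht
  simp only [zero_smul, NormedSpace.exp_zero, one_mul, mul_one, gram_zero, add_zero,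
    Matrix.add_mulVec, dotProduct_add] at h
  have hpos : 0 < x ⬝ᵥ ((NormedSpace.exp (t • Bᵀ) * N * NormedSpace.exp (t • B)) *ᵥ x) := by
    rw [exp_smul_transpose, ← Matrix.mulVec_mulVec, ← Matrix.mulVec_mulVec,
      Matrix.dotProduct_mulVec, Matrix.vecMul_transpose]
    have hne : NormedSpace.exp (t • B) *ᵥ x ≠ 0 := fun h0 =>
      hx (Matrix.mulVec_injective_iff_isUnit.2 (Matrix.isUnit_exp (t • B))
        (by rw [h0, Matrix.mulVec_zero]))
    simpa using hNd.dotProduct_mulVec_pos hne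
  linarith

/-- Write `P = P_∞`. A vector `v` in the kernel gives, for `u = 𝕊_t v`, the relation
`⟨v, u⟩ + ⟨u, Qu⟩ = ⟨u, Pu⟩`. On the other hand `𝕊_t < P⁻¹` gives `⟨u, Pu⟩ < ⟨v, u⟩` unless
`Pu = 0`, and then `⟨v, 𝕊_t v⟩ ≤ 0`, so that `v = 0` by positivity of `𝕊_t`. -/
theorem isUnit_one_add_mul_gram {A R S : Matrix (Fin r) (Fin r) ℝ} (hR : R.PosSemidef)
    (hS : S.PosSemidef) (hAS : NoInvariantKer A S) (hst : IsStabilizing A R S (steady A R S))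
    {Q : Matrix (Fin r) (Fin r) ℝ} (hQ : Q.PosSemidef) {t : ℝ} (ht : 0 ≤ t) :
    IsUnit (1 + (Q - steady A R S) * gram A R S t) := by
  rcases ht.eq_or_lt with rfl | htpos
  · simp [gram_zero]
  have hG := gram_posDef (R := R) hS hAS htpos
  have hlt := fun x hx => dotProduct_gram_lt (x := x) hR hS hst ht hx
  set G := gram A R S t
  have hP := hst.1
  set P := steady A R S
  have hGt := transpose_eq_of_posSemidef hG.posSemidef
  have hPt := transpose_eq_of_posSemidef hP.posSemidef
  rw [← Matrix.mulVec_injective_iff_isUnit]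
  refine (injective_iff_map_eq_zero (Matrix.mulVecLin _)).2 fun v hv => ?_
  by_contra hv0
  rw [Matrix.mulVecLin_apply, Matrix.add_mulVec, Matrix.one_mulVec, ← Matrix.mulVec_mulVec,
    Matrix.sub_mulVec] at hv
  have hvG : 0 < v ⬝ᵥ (G *ᵥ v) := by simpa using hG.dotProduct_mulVec_pos hv0
  set u := G *ᵥ v with hu
  have hQu : 0 ≤ u ⬝ᵥ (Q *ᵥ u) := by simpa using hQ.dotProduct_mulVec_nonneg u
  have hsum : v ⬝ᵥ u + (u ⬝ᵥ (Q *ᵥ u) - u ⬝ᵥ (P *ᵥ u)) = 0 := by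
    have := congrArg (fun y => u ⬝ᵥ y) hv
    simp only [dotProduct_add, dotProduct_sub, dotProduct_zero] at this
    rwa [dotProduct_comm u v] at this
  rcases eq_or_ne (P *ᵥ u) 0 with hw | hw
  · rw [hw, dotProduct_zero] at hsum
    linarith
  · set w := P *ᵥ u with hwdef
    -- with `⟨w, G w⟩ < ⟨w, P⁻¹ w⟩ = ⟨u, w⟩`, positivity at `v - w` gives `⟨u, w⟩ < ⟨v, u⟩`
    have h1 : 0 ≤ (v - w) ⬝ᵥ (G *ᵥ (v - w)) := by
      simpa using hG.posSemidef.dotProduct_mulVec_nonneg (v - w)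
    have h2 := hlt w hw
    have h3 : P⁻¹ *ᵥ w = u := by
      rw [hwdef, Matrix.mulVec_mulVec u P⁻¹ P, Matrix.nonsing_inv_mul P
        ((Matrix.isUnit_iff_isUnit_det P).1 hP.isUnit), Matrix.one_mulVec]
    rw [h3, dotProduct_comm w u] at h2
    have h4 : v ⬝ᵥ (G *ᵥ w) = u ⬝ᵥ w := by
      rw [hu, dotProduct_mulVec_symm hGt v w, dotProduct_comm]
    rw [Matrix.mulVec_sub, sub_dotProduct, dotProduct_sub, dotProduct_sub, h4, ← hu,
      dotProduct_comm w u] at h1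
    linarith

/-- The quadratic forms of the integrand are nonnegative with bounded integrals; the entries are
linear combinations of them by polarization. -/
theorem integrableOn_gramIntegrand {A R S : Matrix (Fin r) (Fin r) ℝ} (hR : R.PosSemidef)
    (hS : S.PosSemidef) (hst : IsStabilizing A R S (steady A R S)) :
    IntegrableOn (gramIntegrand A R S) (Set.Ioi 0) := by
  have hc := continuous_gramIntegrand A R S
  have hquad : ∀ x : Fin r → ℝ,
      IntegrableOn (fun s => x ⬝ᵥ (gramIntegrand A R S s *ᵥ x)) (Set.Ioi 0) := by
    intro x
    have hcx : Continuous fun s => x ⬝ᵥ (gramIntegrand A R S s *ᵥ x) := by fun_prop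
    refine integrableOn_Ioi_of_intervalIntegral_norm_bounded (l := atTop)
      (b := fun n : ℕ => (n : ℝ)) (x ⬝ᵥ ((steady A R S)⁻¹ *ᵥ x)) 0
      (fun n => (hcx.integrableOn_Icc).mono_set Set.Ioc_subset_Icc_self)
      tendsto_natCast_atTop_atTop (Eventually.of_forall fun n => ?_)
    have hnorm : ∀ s, ‖x ⬝ᵥ (gramIntegrand A R S s *ᵥ x)‖
        = x ⬝ᵥ (gramIntegrand A R S s *ᵥ x) := fun s =>
      Real.norm_of_nonneg (by simpa using (gramIntegrand_posSemidef hS s).dotProduct_mulVec_nonneg x)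
    simp only [hnorm]
    rw [intervalIntegral.integral_eq_sub_of_hasDerivAt
      (fun s _ => hasDerivAt_dotProduct_mulVec (hasDerivAt_gram A R S s) x x)
      (hcx.intervalIntegrable _ _), gram_zero, Matrix.zero_mulVec, dotProduct_zero, sub_zero]
    rcases eq_or_ne x 0 with rfl | hx
    · simp
    · exact (dotProduct_gram_lt hR hS hst n.cast_nonneg hx).le
  have hentry : ∀ i j, IntegrableOn (fun s => gramIntegrand A R S s i j) (Set.Ioi 0) := by
    intro i j
    refine ((((hquad (Pi.single i 1 + Pi.single j 1)).sub (hquad (Pi.single i 1))).sub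
      (hquad (Pi.single j 1))).div_const 2).congr (Eventually.of_forall fun s => ?_)
    have hs : gramIntegrand A R S s j i = gramIntegrand A R S s i j :=
      congrFun (congrFun (transpose_eq_of_posSemidef (gramIntegrand_posSemidef hS s)) i) j
    simp only [Pi.sub_apply, Matrix.mulVec_add, add_dotProduct, dotProduct_add,
      Matrix.mulVec_single_one, single_one_dotProduct, Matrix.col_apply, hs]
    ring
  have hdecomp : gramIntegrand A R S = fun s => ∑ i, ∑ j,
      gramIntegrand A R S s i j • Matrix.single i j (1 : ℝ) := by
    funext s
    conv_lhs => rw [Matrix.matrix_eq_sum_single (gramIntegrand A R S s)]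
    simp [Matrix.smul_single]
  rw [hdecomp]
  exact integrable_finsetSum _ fun i _ => integrable_finsetSum _ fun j _ =>
    (hentry i j).smul_const _

theorem tendsto_gram {A R S : Matrix (Fin r) (Fin r) ℝ} (hR : R.PosSemidef)
    (hS : S.PosSemidef) (hst : IsStabilizing A R S (steady A R S)) :
    Tendsto (gram A R S) atTop (𝓝 (gramInf A R S)) :=
  intervalIntegral_tendsto_integral_Ioi 0 (integrableOn_gramIntegrand hR hS hst) tendsto_id

theorem gramInf_posDef {A R S : Matrix (Fin r) (Fin r) ℝ} (hR : R.PosSemidef)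
    (hS : S.PosSemidef) (hAS : NoInvariantKer A S) (hst : IsStabilizing A R S (steady A R S)) :
    (gramInf A R S).PosDef := by
  have hlim := tendsto_gram hR hS hst
  refine Matrix.PosDef.of_dotProduct_mulVec_pos ?_ fun x hx => ?_
  · have h1 : Tendsto (fun t => (gram A R S t)ᵀ) atTop (𝓝 (gramInf A R S)ᵀ) :=
      ((Continuous.matrix_transpose continuous_id).tendsto _).comp hlim
    simp only [gram_transpose hS] at h1
    rw [Matrix.IsHermitian, Matrix.conjTranspose_eq_transpose_of_trivial]
    exact tendsto_nhds_unique h1 hlim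
  · have hc : Continuous fun N : Matrix (Fin r) (Fin r) ℝ => x ⬝ᵥ (N *ᵥ x) := by fun_prop
    have h1 := (gram_posDef (R := R) hS hAS one_pos).dotProduct_mulVec_pos hx
    rw [star_trivial] at h1 ⊢
    refine h1.trans_le (ge_of_tendsto ((hc.tendsto _).comp hlim) ?_)
    filter_upwards [eventually_ge_atTop 1] with t ht
    exact monotone_dotProduct_gram hS x ht

/-! ### The flow and the transition matrix -/

/-- The explicit solution of the Riccati equation. -/
theorem isSolution_explicit {A R S : Matrix (Fin r) (Fin r) ℝ} (hR : R.PosSemidef)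
    (hS : S.PosSemidef) (hAS : NoInvariantKer A S) (hst : IsStabilizing A R S (steady A R S))
    {Q : Matrix (Fin r) (Fin r) ℝ} (hQ : Q.PosSemidef) :
    IsSolution A R S Q fun t => steady A R S + NormedSpace.exp (t • closedLoop A R S) *
      (1 + (Q - steady A R S) * gram A R S t)⁻¹ * (Q - steady A R S) *
        NormedSpace.exp (t • (closedLoop A R S)ᵀ) := by
  refine ⟨by simp [gram_zero], fun t ht => HasDerivAt.hasDerivWithinAt ?_⟩
  have hSt := transpose_eq_of_posSemidef hS
  have hPt := transpose_eq_of_posSemidef hst.1.posSemidef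
  have hu := isUnit_one_add_mul_gram hR hS hAS hst hQ ht
  have hG : HasDerivAt (fun u => 1 + (Q - steady A R S) * gram A R S u)
      ((Q - steady A R S) * gramIntegrand A R S t) t :=
    ((hasDerivAt_gram A R S t).const_mul _).const_add 1
  have hd := ((((hasDerivAt_exp_smul_const' (closedLoop A R S) t).mul
    (hasDerivAt_matrix_inv hG hu)).mul_const (Q - steady A R S)).mul (hasDerivAt_exp_smul_const (closedLoop A R S)ᵀ t)).const_add
      (steady A R S)
  refine hd.congr_deriv ?_
  rw [gramIntegrand, Pi.mul_apply]
  have hBt : (closedLoop A R S)ᵀ = Aᵀ - S * steady A R S := transpose_sub_mul hSt hPt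
  set K := (1 + (Q - steady A R S) * gram A R S t)⁻¹
  set e := NormedSpace.exp (t • closedLoop A R S)
  set e' := NormedSpace.exp (t • (closedLoop A R S)ᵀ)
  set Y := e * K * (Q - steady A R S) * e' with hY
  have hdr : drift A R S (steady A R S + Y) = drift A R S (steady A R S)
      + (closedLoop A R S * Y + Y * (closedLoop A R S)ᵀ - Y * S * Y) := by
    rw [hBt, drift, drift, closedLoop]; noncomm_ring
  rw [hdr, hst.2.1, zero_add, hY]
  noncomm_ring

theorem isSolution_flow {A R S Q : Matrix (Fin r) (Fin r) ℝ}
    (h : ∃ P, IsSolution A R S Q P) : IsSolution A R S Q fun t => flow A R S t Q :=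
  Classical.epsilon_spec h

theorem flow_steady {A R S : Matrix (Fin r) (Fin r) ℝ}
    (hst : IsStabilizing A R S (steady A R S)) {t : ℝ} (ht : 0 ≤ t) :
    flow A R S t (steady A R S) = steady A R S := by
  have hc : IsSolution A R S (steady A R S) fun _ => steady A R S :=
    ⟨rfl, fun t _ => by rw [hst.2.1]; exact hasDerivWithinAt_const _ _ _⟩
  exact (isSolution_flow ⟨_, hc⟩).unique hc ht

theorem transition_steady {A R S : Matrix (Fin r) (Fin r) ℝ}
    (hst : IsStabilizing A R S (steady A R S)) {t : ℝ} (ht : 0 ≤ t) :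
    transition A R S t (steady A R S) = NormedSpace.exp (t • closedLoop A R S) := by
  have hE : IsTransition A R S (steady A R S) fun t => NormedSpace.exp (t • closedLoop A R S) := by
    refine ⟨by simp, fun t ht => ?_⟩
    rw [flow_steady hst ht]
    exact (hasDerivAt_exp_smul_const' (closedLoop A R S) t).hasDerivWithinAt
  have hspec : IsTransition A R S (steady A R S)
      fun t => transition A R S t (steady A R S) := Classical.epsilon_spec ⟨_, hE⟩
  have hlin : ∀ {E : ℝ → Matrix (Fin r) (Fin r) ℝ}, IsTransition A R S (steady A R S) E →
      ∀ t : ℝ, 0 ≤ t → HasDerivWithinAt E (closedLoop A R S * E t) (Set.Ici 0) t :=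
    fun {E} h t ht => by
      have := h.2 t ht
      rwa [flow_steady hst ht] at this
  exact eq_of_hasDerivWithinAt_Ici (v := fun X => closedLoop A R S * X) (by fun_prop)
    (hlin hspec) (hlin hE) (hspec.1.trans hE.1.symm) ht

theorem floquetC_eq {A R S : Matrix (Fin r) (Fin r) ℝ} {t : ℝ} (hG : IsUnit (gram A R S t))
    (Q : Matrix (Fin r) (Fin r) ℝ) :
    floquetC A R S t Q = 1 + (Q - steady A R S) * gram A R S t := by
  rw [floquetC, steadyNeg]
  have h : (gram A R S t)⁻¹ - (gramInf A R S)⁻¹ + (Q - (steady A R S - (gramInf A R S)⁻¹))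
      = (gram A R S t)⁻¹ + (Q - steady A R S) := by abel
  rw [h, add_mul, Matrix.nonsing_inv_mul _ ((Matrix.isUnit_iff_isUnit_det _).1 hG)]

/-- Since `(1 + D₂G)⁻¹D₂ = D₂(1 + GD₂)⁻¹`, the difference is
`(1 + D₁G)⁻¹ (D₁(1 + GD₂) - (1 + D₁G)D₂) (1 + GD₂)⁻¹`. -/
theorem inv_mul_sub_inv_mul {G D₁ D₂ : Matrix (Fin r) (Fin r) ℝ} (hG : Gᵀ = G) (hD₂ : D₂ᵀ = D₂)
    (h₁ : IsUnit (1 + D₁ * G)) (h₂ : IsUnit (1 + D₂ * G)) :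
    (1 + D₁ * G)⁻¹ * D₁ - (1 + D₂ * G)⁻¹ * D₂
      = (1 + D₁ * G)⁻¹ * (D₁ - D₂) * ((1 + D₂ * G)⁻¹)ᵀ := by
  have hd₁ := (Matrix.isUnit_iff_isUnit_det _).1 h₁
  have hd₂ := (Matrix.isUnit_iff_isUnit_det _).1 h₂
  have ht : (1 + D₂ * G)ᵀ = 1 + G * D₂ := by
    rw [Matrix.transpose_add, Matrix.transpose_one, Matrix.transpose_mul, hG, hD₂]
  have hd₃ : IsUnit (1 + G * D₂).det := by rwa [← ht, Matrix.det_transpose]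
  rw [Matrix.transpose_nonsing_inv, ht]
  have hcomm : (1 + D₂ * G)⁻¹ * D₂ = D₂ * (1 + G * D₂)⁻¹ := by
    have h : (1 + D₂ * G) * D₂ = D₂ * (1 + G * D₂) := by noncomm_ring
    calc (1 + D₂ * G)⁻¹ * D₂ = (1 + D₂ * G)⁻¹ * (D₂ * (1 + G * D₂)) * (1 + G * D₂)⁻¹ := by
          rw [mul_assoc, mul_assoc D₂, Matrix.mul_nonsing_inv _ hd₃, mul_one]
      _ = D₂ * (1 + G * D₂)⁻¹ := by
          rw [← h, ← mul_assoc, Matrix.nonsing_inv_mul _ hd₂, one_mul]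
  have hmid : D₁ - D₂ = D₁ * (1 + G * D₂) - (1 + D₁ * G) * D₂ := by noncomm_ring
  rw [hcomm, hmid, mul_sub, sub_mul, mul_assoc, mul_assoc D₁, Matrix.mul_nonsing_inv _ hd₃,
    mul_one, ← mul_assoc _ (1 + D₁ * G), Matrix.nonsing_inv_mul _ hd₁, one_mul]

end Riccati

open Riccati in
theorem mainTheorem2 {r : ℕ} (A R S Rh Sh : Matrix (Fin r) (Fin r) ℝ)
    (hR : R.PosSemidef) (hS : S.PosSemidef)
    (hRh : Rh.IsSymm) (hRh2 : Rh * Rh = R)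
    (hSh : Sh.IsSymm) (hSh2 : Sh * Sh = S)
    (hctrl : Riccati.IsControllable A Rh) (hobs : Riccati.IsObservable A Sh) :
    -- `P_∞` is well defined
    (∃! P : Matrix (Fin r) (Fin r) ℝ, Riccati.IsStabilizing A R S P) ∧
    -- the flow is well defined: a global solution exists and it is unique
    (∀ Q : Matrix (Fin r) (Fin r) ℝ, Q.PosSemidef →
      Riccati.IsSolution A R S Q (fun t => Riccati.flow A R S t Q) ∧
      ∀ P : ℝ → Matrix (Fin r) (Fin r) ℝ, Riccati.IsSolution A R S Q P →
        ∀ t : ℝ, 0 ≤ t → P t = Riccati.flow A R S t Q) ∧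
    -- the matrices that are inverted below, or in `ℂ_t`, are invertible
    (∀ t : ℝ, 0 < t → (Riccati.gram A R S t).PosDef) ∧
    Tendsto (Riccati.gram A R S) atTop (𝓝 (Riccati.gramInf A R S)) ∧
    (Riccati.gramInf A R S).PosDef ∧
    (∀ t : ℝ, 0 < t → ∀ Q : Matrix (Fin r) (Fin r) ℝ, Q.PosSemidef →
      IsUnit (Riccati.floquetC A R S t Q) ∧
      Riccati.floquetC A R S t Q = 1 + (Q - Riccati.steady A R S) * Riccati.gram A R S t) ∧
    -- `E_t(P_∞) = e^{tB}`
    (∀ t : ℝ, 0 ≤ t → Riccati.transition A R S t (Riccati.steady A R S) =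
      NormedSpace.exp (t • Riccati.closedLoop A R S)) ∧
    -- the Lipschitz type formula
    (∀ t : ℝ, 0 < t → ∀ Q₁ Q₂ : Matrix (Fin r) (Fin r) ℝ, Q₁.PosSemidef → Q₂.PosSemidef →
      Riccati.flow A R S t Q₁ - Riccati.flow A R S t Q₂ =
        Riccati.transition A R S t (Riccati.steady A R S) * (Riccati.floquetC A R S t Q₁)⁻¹ *
          (Q₁ - Q₂) *
          (Riccati.transition A R S t (Riccati.steady A R S) *
            (Riccati.floquetC A R S t Q₂)⁻¹)ᵀ) ∧
    -- the Bernstein-Prach-Tekinalp formula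
    (∀ t : ℝ, 0 < t → ∀ Q : Matrix (Fin r) (Fin r) ℝ, Q.PosSemidef →
      Riccati.flow A R S t Q =
        Riccati.steady A R S +
          NormedSpace.exp (t • Riccati.closedLoop A R S) *
            (1 + (Q - Riccati.steady A R S) * Riccati.gram A R S t)⁻¹ *
            (Q - Riccati.steady A R S) *
            NormedSpace.exp (t • (Riccati.closedLoop A R S)ᵀ)) := by
  have hAS : NoInvariantKer A S := by
    have := hobs.noInvariantKer
    rwa [hSh.eq, hSh2] at this
  have hAR : NoInvariantKer Aᵀ R := by
    have := hctrl.isObservable_transpose.noInvariantKer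
    rwa [Matrix.transpose_transpose, hRh.eq, hRh2] at this
  have hex := exists_isStabilizing hR hS hAR hAS
  have hst : IsStabilizing A R S (steady A R S) := Classical.epsilon_spec hex
  have hPt := transpose_eq_of_posSemidef hst.1.posSemidef
  have hflow : ∀ Q : Matrix (Fin r) (Fin r) ℝ, Q.PosSemidef →
      IsSolution A R S Q (fun t => flow A R S t Q) := fun Q hQ =>
    isSolution_flow ⟨_, isSolution_explicit hR hS hAS hst hQ⟩
  have hformula := fun (t : ℝ) (ht : 0 < t) (Q : Matrix (Fin r) (Fin r) ℝ) (hQ : Q.PosSemidef) =>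
    (hflow Q hQ).unique (isSolution_explicit hR hS hAS hst hQ) ht.le
  have hfloquet := fun (t : ℝ) (ht : 0 < t) (Q : Matrix (Fin r) (Fin r) ℝ) =>
    floquetC_eq (gram_posDef (R := R) hS hAS ht).isUnit Q
  have hunit := fun (t : ℝ) (ht : 0 < t) (Q : Matrix (Fin r) (Fin r) ℝ) (hQ : Q.PosSemidef) =>
    isUnit_one_add_mul_gram hR hS hAS hst hQ ht.le
  refine ⟨⟨_, hst, fun P hP => hP.unique (transpose_eq_of_posSemidef hS) hst⟩,
    fun Q hQ => ⟨hflow Q hQ, fun P hP t ht => hP.unique (hflow Q hQ) ht⟩,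
    fun t ht => gram_posDef hS hAS ht, tendsto_gram hR hS hst, gramInf_posDef hR hS hAS hst,
    fun t ht Q hQ => ⟨?_, hfloquet t ht Q⟩, fun t ht => transition_steady hst ht,
    fun t ht Q₁ Q₂ hQ₁ hQ₂ => ?_, hformula⟩
  · rw [hfloquet t ht Q]
    exact hunit t ht Q hQ
  · have hdiff : (Q₂ - steady A R S)ᵀ = Q₂ - steady A R S := by
      rw [Matrix.transpose_sub, transpose_eq_of_posSemidef hQ₂, hPt]
    have hkey := inv_mul_sub_inv_mul (gram_transpose hS t) hdiff (hunit t ht Q₁ hQ₁)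
      (hunit t ht Q₂ hQ₂)
    rw [sub_sub_sub_cancel_right] at hkey
    rw [hformula t ht Q₁ hQ₁, hformula t ht Q₂ hQ₂, add_sub_add_left_eq_sub,
      transition_steady hst ht.le, hfloquet t ht Q₁, hfloquet t ht Q₂, Matrix.transpose_mul,
      exp_smul_transpose, mul_assoc _ _ (Q₁ - steady A R S), mul_assoc _ _ (Q₂ - steady A R S),
      ← sub_mul, ← mul_sub, hkey]
    simp only [mul_assoc]
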